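/- The function $\beta\mapsto \frac{2(1-\beta)^2}{1+\beta}$ is strictly decreasing on $(-1,1)$. Let $n,m\ge 1$, let $f:\mathbb R^n\times\mathbb R^m\to\mathbb R$ be $C^\infty$, and let $(x^*,y^*)$ be a local Nash equilibrium of $\min_x\max_y f(x,y)$, i.e. $x^*$ is a local minimizer of $f(\cdot,y^*)$ and $y^*$ is a local maximizer of $f(x^*,\cdot)$. With all derivatives taken at $(x^*,y^*)$, put $$\mathcal S=\begin{bmatrix}-\nabla_x^2f&0\\0&\nabla_y^2f\end{bmatrix},\qquad \mathcal A=\begin{bmatrix}0&-\nabla_{xy}f\\ \nabla_{yx}f&0\end{bmatrix},\qquad \mathcal J=\mathcal S+\mathcal A,$$ and let $\mathrm{Sp}(\mathcal J)\subset\mathbb C$ be the set of eigenvalues of $\mathcal J$. Assume that $|\mathrm{Im}\,\lambda|>|\mathrm{Re}\,\lambda|$ for all $\lambda\in\mathrm{Sp}(\mathcal J)$, and that no complex eigenvector of $\mathcal A$ lies in the kernel of $\mathcal S$. For $\beta\in(-1,1)$ and $h>0$, Continuous Sim-HB is the system $$\dot x=-\nabla_x\mathcal F(x,y),\quad \dot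 y=\nabla_y\mathcal F(x,y),\qquad \mathcal F=\frac{1}{1-\beta}f+\frac{h(1+\beta)}{4(1-\beta)^3}\left(\|\nabla_xf\|^2-\|\nabla_yf\|^2\right).$$ It is said to converge locally (to $z^*=(x^*,y^*)$) if there are $\delta,C,c>0$ such that from every $z_0$ with $\|z_0-z^*\|\le\delta$ there starts a solution on $[0,\infty)$, and every such solution satisfies $\|z(t)-z^*\|\le Ce^{-ct}$ for all $t>0$. Let $$H(\beta)=\min_{\lambda\in\mathrm{Sp}(\mathcal J)}\frac{2(1-\beta)^2}{1+\beta}\cdot\frac{|\mathrm{Re}\,\lambda|}{(\mathrm{Im}\,\lambda)^2-(\mathrm{Re}\,\lambda)^2}.$$ Then $H(\beta)>0$ for every $\beta\in(-1,1)$, and Continuous Sim-HB converges locally for all $h\in(0,H(\beta))$. Moreover, a smaller momentum permits a wider range of step sizes: if $-1<\beta_1<\beta_2<1$, then $(0,H(\beta_2))\subsetneq(0,H(\beta_1))$, and the set of all $h>0$ for which Continuous Sim-HB with momentum $\beta_2$ converges locally is a proper subset of the corresponding set for $\beta_1$. -/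

import Mathlib

open scoped ContDiff

noncomputable section

namespace MinMaxHB

/-- The joint strategy space `ℝⁿ × ℝᵐ` of a min-max game, each factor with its Euclidean norm. -/
abbrev Strat (n m : ℕ) : Type := EuclideanSpace ℝ (Fin n) × EuclideanSpace ℝ (Fin m)

variable {n m : ℕ}

/-- `(x*, y*)` is a local Nash equilibrium of `min_x max_y f(x, y)`. -/
def IsLocalNash (f : Strat n m → ℝ) (p : Strat n m) : Prop :=
  IsLocalMin (fun x => f (x, p.2)) p.1 ∧ IsLocalMax (fun y => f (p.1, y)) p.2

/-- The partial gradient `∇ₓ f`. -/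
def gradX (f : Strat n m → ℝ) (p : Strat n m) : EuclideanSpace ℝ (Fin n) :=
  gradient (fun x => f (x, p.2)) p.1

/-- The partial gradient `∇_y f`. -/
def gradY (f : Strat n m → ℝ) (p : Strat n m) : EuclideanSpace ℝ (Fin m) :=
  gradient (fun y => f (p.1, y)) p.2

/-- `∇²ₓ f`, with `(i, j)` entry `∂(∇ₓ f)ᵢ / ∂xⱼ`. -/
def hessXX (f : Strat n m → ℝ) (p : Strat n m) : Matrix (Fin n) (Fin n) ℝ :=
  Matrix.of fun i j =>
    fderiv ℝ (fun x => gradX f (x, p.2)) p.1 (EuclideanSpace.single j 1) i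

/-- `∇_{xy} f`, with `(i, j)` entry `∂(∇ₓ f)ᵢ / ∂yⱼ`. -/
def hessXY (f : Strat n m → ℝ) (p : Strat n m) : Matrix (Fin n) (Fin m) ℝ :=
  Matrix.of fun i j =>
    fderiv ℝ (fun y => gradX f (p.1, y)) p.2 (EuclideanSpace.single j 1) i

/-- `∇_{yx} f`, with `(i, j)` entry `∂(∇_y f)ᵢ / ∂xⱼ`. -/
def hessYX (f : Strat n m → ℝ) (p : Strat n m) : Matrix (Fin m) (Fin n) ℝ :=
  Matrix.of fun i j =>
    fderiv ℝ (fun x => gradY f (x, p.2)) p.1 (EuclideanSpace.single j 1) i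

/-- `∇²_y f`, with `(i, j)` entry `∂(∇_y f)ᵢ / ∂yⱼ`. -/
def hessYY (f : Strat n m → ℝ) (p : Strat n m) : Matrix (Fin m) (Fin m) ℝ :=
  Matrix.of fun i j =>
    fderiv ℝ (fun y => gradY f (p.1, y)) p.2 (EuclideanSpace.single j 1) i

/-- The Jacobian `𝒥` at `p` of the gradient descent-ascent flow `ẋ = -∇ₓ f`, `ẏ = ∇_y f`. -/
def jac (f : Strat n m → ℝ) (p : Strat n m) : Matrix (Fin n ⊕ Fin m) (Fin n ⊕ Fin m) ℝ :=
  Matrix.fromBlocks (-hessXX f p) (-hessXY f p) (hessYX f p) (hessYY f p)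

/-- The potential part `𝒮` of `𝒥`. -/
def potentialPart (f : Strat n m → ℝ) (p : Strat n m) :
    Matrix (Fin n ⊕ Fin m) (Fin n ⊕ Fin m) ℝ :=
  Matrix.fromBlocks (-hessXX f p) 0 0 (hessYY f p)

/-- The Hamiltonian part `𝒜` of `𝒥`. -/
def hamiltonianPart (f : Strat n m → ℝ) (p : Strat n m) :
    Matrix (Fin n ⊕ Fin m) (Fin n ⊕ Fin m) ℝ :=
  Matrix.fromBlocks 0 (-hessXY f p) (hessYX f p) 0

/-- `Sp(M)`: the set of complex eigenvalues of a real square matrix. -/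
def Sp {ι : Type} [Fintype ι] [DecidableEq ι] (M : Matrix ι ι ℝ) : Set ℂ :=
  spectrum ℂ (M.map Complex.ofReal)

/-- `EigVec(M)`: the complex eigenvectors of a real square matrix, together with `0`. -/
def EigVec {ι : Type} [Fintype ι] (M : Matrix ι ι ℝ) : Set (ι → ℂ) :=
  {v | ∃ μ : ℂ, (M.map Complex.ofReal).mulVec v = μ • v}

/-- `Ker(M)`: the complex kernel of a real square matrix. -/
def Ker {ι : Type} [Fintype ι] (M : Matrix ι ι ℝ) : Set (ι → ℂ) :=
  {v | (M.map Complex.ofReal).mulVec v = 0}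

/-- Interaction dominates: `|Im λ| > |Re λ|` for every eigenvalue `λ` of `𝒥`. -/
def InteractionDominates (f : Strat n m → ℝ) (p : Strat n m) : Prop :=
  ∀ l ∈ Sp (jac f p), |l.re| < |l.im|

/-- `EigVec(𝒜) ∩ Ker(𝒮) = {0}`. -/
def EigKerTrivial (f : Strat n m → ℝ) (p : Strat n m) : Prop :=
  EigVec (hamiltonianPart f p) ∩ Ker (potentialPart f p) = {0}

/-- The modified loss `ℱ` for momentum `β` and step size `h`. -/
def modifiedLoss (β h : ℝ) (f : Strat n m → ℝ) (p : Strat n m) : ℝ :=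
  1 / (1 - β) * f p
    + h * (1 + β) / (4 * (1 - β) ^ 3) * (‖gradX f p‖ ^ 2 - ‖gradY f p‖ ^ 2)

/-- The vector field of Continuous Sim-HB: `ẋ = -∇ₓ ℱ(x, y)`, `ẏ = ∇_y ℱ(x, y)`. -/
def simHBField (β h : ℝ) (f : Strat n m → ℝ) (p : Strat n m) : Strat n m :=
  (-gradX (modifiedLoss β h f) p, gradY (modifiedLoss β h f) p)

/-- Local convergence of `ż = V(z)` to the point `p`: from every initial condition close to `p`
there is a solution on `[0, ∞)`, and all such solutions approach `p` at a common exponential rate.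
(Whether the norm on the product is the maximum or the Euclidean one does not matter, as `δ` and
`C` are arbitrary.) -/
def LocallyConverges (V : Strat n m → Strat n m) (p : Strat n m) : Prop :=
  ∃ δ > 0, ∃ C > 0, ∃ c > 0, ∀ z₀ : Strat n m, ‖z₀ - p‖ ≤ δ →
    (∃ z : ℝ → Strat n m, z 0 = z₀ ∧ IsIntegralCurveOn z (fun _ => V) (Set.Ici 0)) ∧
    ∀ z : ℝ → Strat n m, z 0 = z₀ → IsIntegralCurveOn z (fun _ => V) (Set.Ici 0) →
      ∀ t > 0, ‖z t - p‖ ≤ C * Real.exp (-c * t)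

/-- The factor `2(1-β)²/(1+β)`. -/
def momentumFactor (β : ℝ) : ℝ := 2 * (1 - β) ^ 2 / (1 + β)

/-- The step-size bound `min_{λ ∈ Sp(𝒥)} 2(1-β)²/(1+β) · |Re λ| / ((Im λ)² - (Re λ)²)`; the
spectrum is finite and, for `n + m > 0`, nonempty, so the infimum is a minimum. -/
def stepBound (f : Strat n m → ℝ) (p : Strat n m) (β : ℝ) : ℝ :=
  sInf ((fun l : ℂ => momentumFactor β * (|l.re| / (l.im ^ 2 - l.re ^ 2))) '' Sp (jac f p))

/-- The step sizes `h > 0` for which Continuous Sim-HB with momentum `β` converges locally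
to `p`. -/
def convergentSteps (f : Strat n m → ℝ) (p : Strat n m) (β : ℝ) : Set ℝ :=
  {h | 0 < h ∧ LocallyConverges (simHBField β h f) p}

end MinMaxHB

end

/-!
At a local Nash equilibrium `∇f = 0`, so the linearization of Continuous Sim-HB is the polynomial
`P = X / (1 - β) - h (1 + β) / (2 (1 - β) ^ 3) X ^ 2` in `𝒥`, with spectrum `P (Sp 𝒥)`. The Nash
condition makes `𝒮` negative semidefinite while `𝒜` is skew, so an eigenvector of `𝒥` with
`Re λ ≥ 0` would be an eigenvector of `𝒜` in `Ker 𝒮`. Hence `Re λ < 0` on `Sp 𝒥`, and then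
`Re P(λ) < 0` says exactly that `h` is below the term of `H(β)` at `λ`.

Local exponential convergence is equivalent to all eigenvalues of the linearization `L` having
negative real part. A linear map without imaginary eigenvalues has a quadratic form `q` that
strictly decreases along its flow. If the spectrum of `L` is in the left half-plane, `q` is
positive definite and serves as a Lyapunov function. Conversely, if convergence has rate `c`, take
`q` for `L + η` with `0 < η < c` chosen so that `L + η` has no imaginary eigenvalues: if `q` took a
negative value, some nearby solution would decay no faster than `e^{-ηt}`. So `q` is nonnegative,
which forces negative real parts on the spectrum of `L + η`. Thus the convergent step sizes form the
whole interval `(0, H(β))`, and every comparison reduces to the monotonicity of the momentum factor.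
-/

namespace MinMaxHB

open Set Filter Topology Module

section Lyapunov

variable {E : Type*} [NormedAddCommGroup E] [NormedSpace ℝ E]

open scoped Manifold in
theorem exists_isIntegralCurve_of_hasCompactSupport [CompleteSpace E] {v : E → E}
    (hv : ContDiff ℝ 1 v) (hs : HasCompactSupport v) (x : E) :
    ∃ z : ℝ → E, z 0 = x ∧ IsIntegralCurve z fun _ => v := by
  obtain ⟨K, hK⟩ := hv.lipschitzWith_of_hasCompactSupport hs one_ne_zero
  obtain ⟨M, hM⟩ := hs.exists_bound_of_continuous hv.continuous
  have local_solution (y : E) : ∃ z : ℝ → E, z 0 = y ∧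
      ∀ t ∈ Icc (-1 : ℝ) 1, HasDerivWithinAt z (v (z t)) (Icc (-1) 1) t :=
    IsPicardLindelof.exists_eq_forall_mem_Icc_hasDerivWithinAt₀ (t₀ := ⟨0, by simp⟩)
      (show IsPicardLindelof (fun _ => v) _ y M.toNNReal 0 M.toNNReal K from
        { lipschitzOnWith := fun _ _ => hK.lipschitzOnWith
          continuousOn := fun _ _ => continuousOn_const
          norm_le := fun _ _ w _ => (hM w).trans (Real.le_coe_toNNReal M)
          mul_max_le := by simp })
  obtain ⟨z, hz0, hz⟩ := exists_isMIntegralCurve_of_isMIntegralCurveOn (I := 𝓘(ℝ, E)) (v := v)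
    (contMDiff_vectorSpace_iff_contDiff.2 hv) one_pos (fun y => by
      obtain ⟨z, hz0, hz⟩ := local_solution y
      exact ⟨z, hz0, fun t ht => ((hz t (Ioo_subset_Icc_self ht)).mono
        Ioo_subset_Icc_self).hasFDerivWithinAt.hasMFDerivWithinAt⟩)
    x
  exact ⟨z, hz0, fun t => (hz t).hasFDerivAt⟩

theorem exists_mul_norm_sq_le [FiniteDimensional ℝ E] (b : E →L[ℝ] E →L[ℝ] ℝ)
    (hb : ∀ x, x ≠ 0 → 0 < b x x) : ∃ κ > 0, ∀ x, κ * ‖x‖ ^ 2 ≤ b x x := by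
  rcases subsingleton_or_nontrivial E with _ | _
  · exact ⟨1, one_pos, fun x => by simp [Subsingleton.elim x 0]⟩
  have : ProperSpace E := FiniteDimensional.proper_real E
  obtain ⟨x₀, hx₀, hmin⟩ := (isCompact_sphere (0 : E) 1).exists_isMinOn
    (NormedSpace.sphere_nonempty.2 zero_le_one)
    (show Continuous fun x => b x x by fun_prop).continuousOn
  refine ⟨b x₀ x₀, hb x₀ (Metric.ne_of_mem_sphere hx₀ one_ne_zero), fun x => ?_⟩
  rcases eq_or_ne x 0 with rfl | hx
  · simp
  have hnorm : 0 < ‖x‖ := norm_pos_iff.2 hx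
  have hunit : b x₀ x₀ ≤ b (‖x‖⁻¹ • x) (‖x‖⁻¹ • x) :=
    hmin (by simp [norm_smul, hnorm.ne'])
  simp only [map_smul, smul_apply, smul_eq_mul] at hunit
  rwa [← mul_assoc, ← mul_inv, ← sq, le_inv_mul_iff₀ (by positivity), mul_comm] at hunit

/-- `x ↦ q x x` is strictly decreasing along every nonzero trajectory of `ẋ = L x`. No definiteness
of `q` is asked for, so that the notion covers the functions of both Lyapunov's stability theorem
and Chetaev's instability theorem. -/
structure IsStrictLyapunovForm (q : E →L[ℝ] E →L[ℝ] ℝ) (L : E →L[ℝ] E) : Prop where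
  symm : ∀ x y, q x y = q y x
  apply_self_neg : ∀ x, x ≠ 0 → q x (L x) < 0

theorem IsStrictLyapunovForm.exists_forall_norm_sub_le [FiniteDimensional ℝ E]
    {q : E →L[ℝ] E →L[ℝ] ℝ} {L : E →L[ℝ] E} (hq : IsStrictLyapunovForm q L) {V : E → E} {p : E}
    (hV : HasFDerivAt V L p) (hp : V p = 0) :
    ∃ κ > 0, ∃ r > 0, ∀ x, ‖x - p‖ ≤ r → q (x - p) (V x) ≤ -κ * ‖x - p‖ ^ 2 := by
  obtain ⟨κ, hκ, hcoercive⟩ := exists_mul_norm_sq_le (-q.bilinearComp (.id ℝ E) L)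
    (fun x hx => by simpa using hq.apply_self_neg x hx)
  have hremainder := (hasFDerivAt_iff_isLittleO.1 hV).def (show 0 < κ / 2 / (‖q‖ + 1) by positivity)
  obtain ⟨r, hr, hball⟩ := Metric.nhds_basis_closedBall.mem_iff.1 hremainder
  refine ⟨κ / 2, half_pos hκ, r, hr, fun x hx => ?_⟩
  have hx : ‖V x - L (x - p)‖ ≤ κ / 2 / (‖q‖ + 1) * ‖x - p‖ := by
    simpa [hp] using hball (mem_closedBall_iff_norm.2 hx)
  have hquadratic : q (x - p) (V x - L (x - p)) ≤ κ / 2 * ‖x - p‖ ^ 2 := calc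
    q (x - p) (V x - L (x - p)) ≤ ‖q‖ * ‖x - p‖ * ‖V x - L (x - p)‖ :=
      (le_abs_self _).trans (q.le_opNorm₂ _ _)
    _ ≤ (‖q‖ + 1) * ‖x - p‖ * (κ / 2 / (‖q‖ + 1) * ‖x - p‖) := by gcongr; linarith
    _ = κ / 2 * ‖x - p‖ ^ 2 := by field_simp
  have hlinear : κ * ‖x - p‖ ^ 2 ≤ -q (x - p) (L (x - p)) := by simpa using hcoercive (x - p)
  rw [map_sub] at hquadratic
  linarith

theorem le_mul_exp_of_deriv_lt {u u' : ℝ → ℝ} {a c : ℝ}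
    (hu : ∀ s ∈ Ici 0, HasDerivWithinAt u (u' s) (Ici 0) s) (h₀ : u 0 ≤ a)
    (hlt : ∀ s ∈ Ici 0, u s = a * Real.exp (-c * s) → u' s < -c * u s) {t : ℝ} (ht : 0 ≤ t) :
    u t ≤ a * Real.exp (-c * t) := by
  have hbarrier (s : ℝ) :
      HasDerivAt (fun s => a * Real.exp (-c * s)) (-c * (a * Real.exp (-c * s))) s := by
    refine (((hasDerivAt_id' s).const_mul (-c)).exp.const_mul a).congr_deriv ?_
    ring
  refine image_le_of_deriv_right_lt_deriv_boundary' (a := 0) (b := t)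
    (fun s hs => ((hu s hs.1).continuousWithinAt).mono Icc_subset_Ici_self)
    (fun s hs => (hu s hs.1).mono (Ici_subset_Ici.2 hs.1)) (by simpa using h₀)
    (fun s _ => (hbarrier s).continuousAt.continuousWithinAt)
    (fun s _ => (hbarrier s).hasDerivWithinAt) (fun s hs heq => ?_) (right_mem_Icc.2 ht)
  exact heq ▸ hlt s hs.1 heq

theorem hasDerivWithinAt_apply_self {q : E →L[ℝ] E →L[ℝ] ℝ} (hq : ∀ x y, q x y = q y x)
    {z : ℝ → E} {z' : E} (p : E) {s : Set ℝ} {t : ℝ} (hz : HasDerivWithinAt z z' s t) :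
    HasDerivWithinAt (fun t => q (z t - p) (z t - p)) (2 * q (z t - p) z') s t := by
  have hsub : HasDerivWithinAt (fun t => z t - p) z' s t := hz.sub_const p
  refine ((q.hasFDerivAt.comp_hasDerivWithinAt t hsub).clm_apply hsub).congr_deriv ?_
  rw [hq z', two_mul]; rfl

theorem norm_sub_le_of_lyapunov {q : E →L[ℝ] E →L[ℝ] ℝ} (hq : ∀ x y, q x y = q y x) {α β κ r : ℝ}
    (hα : 0 < α) (hβ : 0 < β) (hκ : 0 < κ) (hr : 0 < r) (hlower : ∀ x, α * ‖x‖ ^ 2 ≤ q x x)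
    (hupper : ∀ x, q x x ≤ β * ‖x‖ ^ 2) {V : E → E} {p : E}
    (hdecrease : ∀ x, ‖x - p‖ ≤ r → q (x - p) (V x) ≤ -κ * ‖x - p‖ ^ 2) {z : ℝ → E}
    (hz : IsIntegralCurveOn z (fun _ => V) (Ici 0)) (hz₀ : ‖z 0 - p‖ ≤ r * √(α / β))
    {t : ℝ} (ht : 0 ≤ t) : ‖z t - p‖ ≤ r * Real.exp (-(κ / (2 * β)) * t) := by
  have hinitial : q (z 0 - p) (z 0 - p) ≤ α * r ^ 2 := calc
    q (z 0 - p) (z 0 - p) ≤ β * (r * √(α / β)) ^ 2 := (hupper _).trans (by gcongr)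
    _ = α * r ^ 2 := by rw [mul_pow, Real.sq_sqrt (by positivity)]; field_simp
  have hdecay : q (z t - p) (z t - p) ≤ α * r ^ 2 * Real.exp (-(κ / β) * t) := by
    refine le_mul_exp_of_deriv_lt (fun s hs => hasDerivWithinAt_apply_self hq p (hz s hs))
      hinitial (fun s hs heq => ?_) ht
    have hpos : 0 < q (z s - p) (z s - p) := heq ▸ by positivity
    have hexp : Real.exp (-(κ / β) * s) ≤ 1 :=
      Real.exp_le_one_iff.2 (mul_nonpos_of_nonpos_of_nonneg (neg_nonpos.2 (by positivity)) hs)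
    have hball : ‖z s - p‖ ≤ r := by
      refine le_of_sq_le_sq (le_of_mul_le_mul_left ?_ hα) hr.le
      calc α * ‖z s - p‖ ^ 2 ≤ α * r ^ 2 * Real.exp (-(κ / β) * s) := heq ▸ hlower _
        _ ≤ α * r ^ 2 := mul_le_of_le_one_right (by positivity) hexp
    calc 2 * q (z s - p) (V (z s)) ≤ 2 * (-κ * ‖z s - p‖ ^ 2) := by gcongr; exact hdecrease _ hball
      _ = -(2 * (κ / β)) * (β * ‖z s - p‖ ^ 2) := by field_simp
      _ ≤ -(2 * (κ / β)) * q (z s - p) (z s - p) :=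
        mul_le_mul_of_nonpos_left (hupper _) (neg_nonpos.2 (by positivity))
      _ < -(κ / β) * q (z s - p) (z s - p) := by
        have : 0 < κ / β * q (z s - p) (z s - p) := by positivity
        linarith
  refine le_of_sq_le_sq (le_of_mul_le_mul_left ?_ hα) (by positivity)
  calc α * ‖z t - p‖ ^ 2 ≤ α * r ^ 2 * Real.exp (-(κ / β) * t) := (hlower _).trans hdecay
    _ = α * (r * Real.exp (-(κ / (2 * β)) * t)) ^ 2 := by
      rw [mul_pow, ← Real.exp_nat_mul, ← mul_assoc]
      congr 2
      push_cast; field_simp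

/-- `LocallyConverges` on an arbitrary normed space. -/
def ConvergesExponentially (V : E → E) (p : E) : Prop :=
  ∃ δ > 0, ∃ C > 0, ∃ c > 0, ∀ z₀ : E, ‖z₀ - p‖ ≤ δ →
    (∃ z : ℝ → E, z 0 = z₀ ∧ IsIntegralCurveOn z (fun _ => V) (Ici 0)) ∧
    ∀ z : ℝ → E, z 0 = z₀ → IsIntegralCurveOn z (fun _ => V) (Ici 0) →
      ∀ t > 0, ‖z t - p‖ ≤ C * Real.exp (-c * t)

theorem IsStrictLyapunovForm.convergesExponentially [FiniteDimensional ℝ E] {V : E → E} {p : E}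
    {q : E →L[ℝ] E →L[ℝ] ℝ} (hq : IsStrictLyapunovForm q (fderiv ℝ V p))
    (hpos : ∀ x, x ≠ 0 → 0 < q x x) (hV : ContDiff ℝ 1 V) (hp : V p = 0) :
    ConvergesExponentially V p := by
  have : CompleteSpace E := FiniteDimensional.complete ℝ E
  have : ProperSpace E := FiniteDimensional.proper_real E
  obtain ⟨α, hα, hlower⟩ := exists_mul_norm_sq_le q hpos
  obtain ⟨κ, hκ, r, hr, hdecrease⟩ :=
    hq.exists_forall_norm_sub_le (hV.differentiable one_ne_zero p).hasFDerivAt hp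
  have hupper (x : E) : q x x ≤ (‖q‖ + 1) * ‖x‖ ^ 2 := by
    have := (le_abs_self _).trans (q.le_opNorm₂ x x)
    nlinarith [sq_nonneg ‖x‖]
  have hβ : 0 < ‖q‖ + 1 := by positivity
  refine ⟨r * √(α / (‖q‖ + 1)), by positivity, r, hr, κ / (2 * (‖q‖ + 1)), by positivity,
    fun z₀ hz₀ => ⟨?_, fun z hz0 hz t ht => norm_sub_le_of_lyapunov hq.symm hα hβ hκ hr hlower
      hupper hdecrease hz (hz0 ▸ hz₀) (le_of_lt ht)⟩⟩
  let χ : ContDiffBump p := ⟨r, r + 1, hr, lt_add_one r⟩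
  have hχ (x : E) (hx : ‖x - p‖ ≤ r) : χ x • V x = V x := by
    rw [χ.one_of_mem_closedBall (mem_closedBall_iff_norm.2 hx), one_smul]
  obtain ⟨z, hz0, hz⟩ := exists_isIntegralCurve_of_hasCompactSupport
    (v := fun x => χ x • V x) (χ.contDiff.smul hV) χ.hasCompactSupport.smul_right z₀
  refine ⟨z, hz0, fun t ht => ?_⟩
  have hball : ‖z t - p‖ ≤ r := by
    refine (norm_sub_le_of_lyapunov hq.symm hα hβ hκ hr hlower hupper
      (fun x hx => (hχ x hx).symm ▸ hdecrease x hx) (hz.isIntegralCurveOn _) (hz0 ▸ hz₀) ht).trans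
      (mul_le_of_le_one_right hr.le (Real.exp_le_one_iff.2 ?_))
    exact mul_nonpos_of_nonpos_of_nonneg (neg_nonpos.2 (by positivity)) ht
  exact (hz t).hasDerivWithinAt.congr_deriv (hχ _ hball)

theorem exists_forall_integralCurve_norm_sub_le {V : E → E} {p : E}
    (hV : DifferentiableAt ℝ V p) (hp : V p = 0) {r : ℝ} (hr : 0 < r) (T : ℝ) :
    ∃ ε > 0, ∀ z : ℝ → E, IsIntegralCurveOn z (fun _ => V) (Ici 0) → ‖z 0 - p‖ ≤ ε →
      ∀ t ∈ Icc 0 T, ‖z t - p‖ ≤ r := by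
  obtain ⟨K, hK, hlipschitz⟩ := hV.hasFDerivAt.isBigO_sub.exists_pos
  obtain ⟨ρ, hρ, hball⟩ := Metric.nhds_basis_closedBall.mem_iff.1 hlipschitz.bound
  set R := min r ρ
  have hR : 0 < R := lt_min hr hρ
  have hbound (x : E) (hx : ‖x - p‖ ≤ R) : ‖V x‖ ≤ K * ‖x - p‖ := by
    simpa [hp] using hball (mem_closedBall_iff_norm.2 (hx.trans (min_le_right _ _)))
  refine ⟨R * Real.exp ((K + 1) * (0 - T)), by positivity, fun z hz hz₀ t ht => ?_⟩
  have hbarrier (s : ℝ) : HasDerivAt (fun s => R * Real.exp ((K + 1) * (s - T)))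
      ((K + 1) * (R * Real.exp ((K + 1) * (s - T)))) s := by
    refine ((((hasDerivAt_id' s).sub_const T).const_mul (K + 1)).exp.const_mul R).congr_deriv ?_
    ring
  have hle (s : ℝ) (hs : s ≤ T) : R * Real.exp ((K + 1) * (s - T)) ≤ R :=
    mul_le_of_le_one_right hR.le
      (Real.exp_le_one_iff.2 (mul_nonpos_of_nonneg_of_nonpos (by positivity) (by linarith)))
  refine (image_norm_le_of_norm_deriv_right_lt_deriv_boundary' (a := 0) (b := T)
    (fun s hs => ((hz s hs.1).continuousWithinAt.mono Icc_subset_Ici_self).sub_const p)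
    (fun s hs => ((hz s hs.1).mono (Ici_subset_Ici.2 hs.1)).sub_const p)
    hz₀
    (fun s _ => (hbarrier s).continuousAt.continuousWithinAt)
    (fun s _ => (hbarrier s).hasDerivWithinAt) (fun s hs heq => ?_) ht).trans
    ((hle t ht.2).trans (min_le_left _ _))
  have hpos : 0 < R * Real.exp ((K + 1) * (s - T)) := by positivity
  have hVz := hbound (z s) (heq.trans_le (hle s hs.2.le))
  rw [heq] at hVz
  linarith

theorem nonneg_of_neg_mul_exp_le {a M c η : ℝ} (hη : η < c)
    (h : ∀ t > 0, -(M * Real.exp (-c * t)) ≤ a * Real.exp (-η * t)) : 0 ≤ a := by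
  have htendsto : Tendsto (fun t => -(M * Real.exp ((η - c) * t))) atTop (𝓝 0) := by
    simpa using ((Real.tendsto_exp_atBot.comp
      (tendsto_id.const_mul_atTop_of_neg (sub_neg.2 hη))).const_mul M).neg
  refine le_of_tendsto htendsto ((eventually_gt_atTop 0).mono fun t ht => ?_)
  refine le_of_mul_le_mul_right (le_of_eq_of_le ?_ (h t ht)) (Real.exp_pos (-η * t))
  rw [neg_mul, mul_assoc, ← Real.exp_add]
  ring_nf

theorem apply_self_le_mul_exp {q : E →L[ℝ] E →L[ℝ] ℝ} (hq : ∀ x y, q x y = q y x) {κ η r : ℝ}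
    (hκ : 0 < κ) {V : E → E} {p : E}
    (hdecrease : ∀ x, ‖x - p‖ ≤ r → q (x - p) (V x + η • (x - p)) ≤ -κ * ‖x - p‖ ^ 2) {z : ℝ → E}
    (hz : IsIntegralCurveOn z (fun _ => V) (Ici 0)) (hball : ∀ t ≥ 0, ‖z t - p‖ ≤ r)
    (hneg : q (z 0 - p) (z 0 - p) < 0) {t : ℝ} (ht : 0 ≤ t) :
    q (z t - p) (z t - p) ≤ q (z 0 - p) (z 0 - p) * Real.exp (-(2 * η) * t) := by
  refine le_mul_exp_of_deriv_lt (fun s hs => hasDerivWithinAt_apply_self hq p (hz s hs))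
    le_rfl (fun s hs heq => ?_) ht
  have hne : z s - p ≠ 0 := by
    intro h
    simp only [h, map_zero] at heq
    exact (mul_neg_of_neg_of_pos hneg (Real.exp_pos _)).ne heq.symm
  have hstrict : q (z s - p) (V (z s) + η • (z s - p)) < 0 :=
    (hdecrease _ (hball s hs)).trans_lt
      (mul_neg_of_neg_of_pos (neg_neg_of_pos hκ) (pow_pos (norm_pos_iff.2 hne) 2))
  simp only [map_add, map_smul, smul_eq_mul] at hstrict
  linarith

theorem ConvergesExponentially.exists_forall_integralCurve_norm_sub_le {V : E → E} {p : E}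
    (h : ConvergesExponentially V p) (hV : DifferentiableAt ℝ V p) (hp : V p = 0) {r : ℝ}
    (hr : 0 < r) :
    ∃ ε > 0, ∀ z : ℝ → E, IsIntegralCurveOn z (fun _ => V) (Ici 0) → ‖z 0 - p‖ ≤ ε →
      ∀ t ≥ 0, ‖z t - p‖ ≤ r := by
  obtain ⟨δ, hδ, C, -, c, hc, hconv⟩ := h
  have hexp : Tendsto (fun t => C * Real.exp (-c * t)) atTop (𝓝 0) := by
    simpa using (Real.tendsto_exp_atBot.comp
      (tendsto_id.const_mul_atTop_of_neg (neg_neg_of_pos hc))).const_mul C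
  obtain ⟨T, hT⟩ := eventually_atTop.1
    ((hexp.eventually (ge_mem_nhds hr)).and (eventually_gt_atTop 0))
  obtain ⟨ε, hε, hstay⟩ := MinMaxHB.exists_forall_integralCurve_norm_sub_le hV hp hr T
  refine ⟨min δ ε, lt_min hδ hε, fun z hz hz₀ t ht => ?_⟩
  rcases le_or_gt t T with hle | hlt
  · exact hstay z hz (hz₀.trans (min_le_right _ _)) t ⟨ht, hle⟩
  · obtain ⟨hexp_le, hpos⟩ := hT t hlt.le
    exact ((hconv _ (hz₀.trans (min_le_left _ _))).2 z rfl hz t hpos).trans hexp_le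

-- If `q x x < 0`, a solution starting at `p + s • x` keeps `q ≤ -k e^{-2ηt}`, against its decay at
-- the rate `c > η`.
theorem ConvergesExponentially.exists_apply_self_nonneg [FiniteDimensional ℝ E] {V : E → E} {p : E}
    {L : E →L[ℝ] E} (h : ConvergesExponentially V p) (hV : HasFDerivAt V L p) (hp : V p = 0) :
    ∃ c > (0 : ℝ), ∀ η < c, ∀ q, IsStrictLyapunovForm q (L + η • .id ℝ E) → ∀ x, 0 ≤ q x x := by
  have hstable {r : ℝ} (hr : 0 < r) :=
    h.exists_forall_integralCurve_norm_sub_le hV.differentiableAt hp hr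
  obtain ⟨δ, hδ, C, hC, c, hc, hconv⟩ := h
  refine ⟨c, hc, fun η hη q hq x => ?_⟩
  have hshift : HasFDerivAt (fun x => V x + η • (x - p)) (L + η • .id ℝ E) p :=
    hV.add (((hasFDerivAt_id p).sub_const p).const_smul η)
  obtain ⟨κ, hκ, r, hr, hdecrease⟩ := hq.exists_forall_norm_sub_le hshift (by simp [hp])
  obtain ⟨ε, hε, hstay⟩ := hstable hr
  obtain ⟨s, hs, hsx⟩ : ∃ s : ℝ, 0 < s ∧ ‖s • x‖ ≤ min δ ε := by
    have hsmul : Tendsto (fun s : ℝ => ‖s • x‖) (𝓝[>] 0) (𝓝 0) :=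
      (Continuous.tendsto' (by fun_prop) 0 0 (by simp)).mono_left nhdsWithin_le_nhds
    exact (eventually_mem_nhdsWithin.and
      (hsmul.eventually (ge_mem_nhds (lt_min hδ hε)))).exists
  obtain ⟨⟨z, hz0, hz⟩, hdecay⟩ := hconv (p + s • x) (by simpa using hsx.trans (min_le_left _ _))
  replace hdecay := hdecay z hz0 hz
  have hy : z 0 - p = s • x := by simp [hz0]
  have hball := hstay z hz (hy ▸ hsx.trans (min_le_right _ _))
  have hscale : q (z 0 - p) (z 0 - p) = s ^ 2 * q x x := by
    simp only [hy, map_smul, smul_apply, smul_eq_mul]; ring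
  refine nonneg_of_mul_nonneg_right (b := q x x) ?_ (pow_pos hs 2)
  rw [← hscale]
  by_contra! hneg
  refine hneg.not_ge (nonneg_of_neg_mul_exp_le (M := ‖q‖ * C ^ 2) (c := 2 * c) (η := 2 * η)
    (by linarith) fun t ht => ?_)
  calc -(‖q‖ * C ^ 2 * Real.exp (-(2 * c) * t))
      = -(‖q‖ * (C * Real.exp (-c * t)) * (C * Real.exp (-c * t))) := by
        rw [show -(2 * c) * t = -c * t + -c * t by ring, Real.exp_add]; ring
    _ ≤ -(‖q‖ * ‖z t - p‖ * ‖z t - p‖) := by gcongr <;> exact hdecay t ht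
    _ ≤ q (z t - p) (z t - p) := neg_le_of_abs_le (q.le_opNorm₂ _ _)
    _ ≤ q (z 0 - p) (z 0 - p) * Real.exp (-(2 * η) * t) :=
      apply_self_le_mul_exp hq.symm hκ hdecrease hz hball hneg ht.le

end Lyapunov

section LyapunovForm

theorem IsStrictLyapunovForm.comp {E F : Type*} [NormedAddCommGroup E] [NormedSpace ℝ E]
    [NormedAddCommGroup F] [NormedSpace ℝ F] {q : F →L[ℝ] F →L[ℝ] ℝ} {M : F →L[ℝ] F}
    (hq : IsStrictLyapunovForm q M) {j : E →L[ℝ] F} (hj : Function.Injective j) {L : E →L[ℝ] E}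
    (hjL : ∀ x, j (L x) = M (j x)) : IsStrictLyapunovForm (q.bilinearComp j j) L where
  symm x y := hq.symm _ _
  apply_self_neg x hx := by
    simpa [hjL] using hq.apply_self_neg (j x) ((map_ne_zero_iff j hj).2 hx)

-- Weighting the driving block heavily absorbs the coupling term `q₂ (π₂ x) (B (π₁ x))`.
theorem IsStrictLyapunovForm.exists_blockTriangular {E F₁ F₂ : Type*} [NormedAddCommGroup E]
    [NormedSpace ℝ E] [NormedAddCommGroup F₁] [NormedSpace ℝ F₁] [FiniteDimensional ℝ F₁]
    [NormedAddCommGroup F₂] [NormedSpace ℝ F₂] [FiniteDimensional ℝ F₂]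
    {q₁ : F₁ →L[ℝ] F₁ →L[ℝ] ℝ} {L₁ : F₁ →L[ℝ] F₁} (hq₁ : IsStrictLyapunovForm q₁ L₁)
    {q₂ : F₂ →L[ℝ] F₂ →L[ℝ] ℝ} {L₂ : F₂ →L[ℝ] F₂} (hq₂ : IsStrictLyapunovForm q₂ L₂)
    {L : E →L[ℝ] E} {π₁ : E →L[ℝ] F₁} {π₂ : E →L[ℝ] F₂} {B : F₁ →L[ℝ] F₂}
    (hπ : ∀ x, x ≠ 0 → π₁ x ≠ 0 ∨ π₂ x ≠ 0) (hL₁ : ∀ x, π₁ (L x) = L₁ (π₁ x))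
    (hL₂ : ∀ x, π₂ (L x) = L₂ (π₂ x) + B (π₁ x)) :
    ∃ K > (0 : ℝ),
      IsStrictLyapunovForm (K • q₁.bilinearComp π₁ π₁ + q₂.bilinearComp π₂ π₂) L := by
  obtain ⟨κ₁, hκ₁, h₁⟩ := exists_mul_norm_sq_le (-q₁.bilinearComp (.id ℝ F₁) L₁)
    (fun x hx => by simpa using hq₁.apply_self_neg x hx)
  obtain ⟨κ₂, hκ₂, h₂⟩ := exists_mul_norm_sq_le (-q₂.bilinearComp (.id ℝ F₂) L₂)
    (fun x hx => by simpa using hq₂.apply_self_neg x hx)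
  set c := ‖q₂‖ * ‖B‖
  have hcoupling (x : E) : q₂ (π₂ x) (B (π₁ x)) ≤
      κ₂ / 2 * ‖π₂ x‖ ^ 2 + c ^ 2 / (2 * κ₂) * ‖π₁ x‖ ^ 2 := calc
    q₂ (π₂ x) (B (π₁ x)) ≤ ‖q₂‖ * ‖π₂ x‖ * ‖B (π₁ x)‖ :=
      (le_abs_self _).trans (q₂.le_opNorm₂ _ _)
    _ ≤ ‖q₂‖ * ‖π₂ x‖ * (‖B‖ * ‖π₁ x‖) := by gcongr; exact B.le_opNorm _
    _ = κ₂ / 2 * ‖π₂ x‖ ^ 2 + c ^ 2 / (2 * κ₂) * ‖π₁ x‖ ^ 2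
        - (κ₂ * ‖π₂ x‖ - c * ‖π₁ x‖) ^ 2 / (2 * κ₂) := by field_simp; ring
    _ ≤ _ := sub_le_self _ (by positivity)
  refine ⟨(c ^ 2 / (2 * κ₂) + 1) / κ₁, by positivity, fun x y => ?_, fun x hx => ?_⟩
  · simp [hq₁.symm (π₁ x), hq₂.symm (π₂ x)]
  have hpos : 0 < ‖π₁ x‖ ^ 2 + κ₂ / 2 * ‖π₂ x‖ ^ 2 := by
    rcases hπ x hx with h | h <;> have := norm_pos_iff.2 h <;> positivity
  have hdriving : (c ^ 2 / (2 * κ₂) + 1) / κ₁ * q₁ (π₁ x) (L₁ (π₁ x)) ≤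
      -((c ^ 2 / (2 * κ₂) + 1) * ‖π₁ x‖ ^ 2) := calc
    _ ≤ (c ^ 2 / (2 * κ₂) + 1) / κ₁ * -(κ₁ * ‖π₁ x‖ ^ 2) := by
      gcongr; exact le_neg_of_le_neg (h₁ _)
    _ = _ := by field_simp
  have hdriven : κ₂ * ‖π₂ x‖ ^ 2 ≤ -q₂ (π₂ x) (L₂ (π₂ x)) := h₂ (π₂ x)
  simp only [add_apply, smul_apply, ContinuousLinearMap.bilinearComp_apply, hL₁, hL₂, map_add,
    smul_eq_mul]
  linarith [hcoupling x]

theorem isStrictLyapunovForm_mul {μ : ℂ} (hμ : μ.re ≠ 0) :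
    IsStrictLyapunovForm (-μ.re • isBoundedBilinearMap_inner.toContinuousLinearMap)
      ((ContinuousLinearMap.mul ℂ ℂ μ).restrictScalars ℝ) where
  symm x y := congrArg (-μ.re * ·) (real_inner_comm y x)
  apply_self_neg x hx := by
    have hinner : inner ℝ x (μ * x) = μ.re * ‖x‖ ^ 2 := by
      rw [Complex.inner, mul_assoc, Complex.mul_conj, Complex.re_mul_ofReal,
        Complex.normSq_eq_norm_sq]
    change -μ.re * inner ℝ x (μ * x) < 0
    rw [hinner, neg_mul, neg_lt_zero, ← mul_assoc]
    have := norm_pos_iff.2 hx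
    have := mul_self_pos.2 hμ
    positivity

theorem exists_dual_comp_eq_mul {K V : Type*} [Field K] [AddCommGroup V] [Module K V]
    [FiniteDimensional K V] {T : End K V} {μ : K} (hμ : T.HasEigenvalue μ) :
    ∃ φ : Dual K V, φ ≠ 0 ∧ ∀ x, φ (T x) = μ * φ x := by
  have hrange : LinearMap.range (T - algebraMap K (End K V) μ) < ⊤ := by
    refine lt_top_iff_ne_top.2 fun h => hμ.mem_spectrum ?_
    exact IsUnit.sub_iff.1 ((LinearMap.isUnit_iff_range_eq_top _).2 h)
  obtain ⟨φ, hφ, hker⟩ := Submodule.exists_le_ker_of_lt_top _ hrange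
  refine ⟨φ, hφ, fun x => ?_⟩
  have : φ (T x - μ • x) = 0 := hker ⟨x, rfl⟩
  simpa [sub_eq_zero] using this

theorem exists_projection_ker {𝕜 V : Type*} [NormedField 𝕜] [NormedAddCommGroup V]
    [NormedSpace 𝕜 V] {T : V →L[𝕜] V} {φ : V →L[𝕜] 𝕜} (hφ : φ ≠ 0)
    (hT : ∀ x ∈ φ.ker, T x ∈ φ.ker) :
    ∃ (π : V →L[𝕜] φ.ker) (w : φ.ker),
      (∀ x, x ≠ 0 → φ x ≠ 0 ∨ π x ≠ 0) ∧ ∀ x, π (T x) = T.restrict hT (π x) + φ x • w := by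
  obtain ⟨e, he⟩ : ∃ e, φ e = 1 :=
    LinearMap.surjective (mt (ContinuousLinearMap.coe_injective (a₂ := 0)) hφ) 1
  let π : V →L[𝕜] φ.ker :=
    (.id 𝕜 V - φ.smulRight e).codRestrict _ fun x => by simp [he]
  have hdecomp (x : V) : φ x • e + π x = x := add_sub_cancel _ _
  have hker (y : φ.ker) : π y = y :=
    Subtype.ext (by simpa [show φ y = 0 from y.2] using hdecomp y)
  refine ⟨π, π (T e), fun x hx => ?_, fun x => ?_⟩
  · contrapose! hx
    rw [← hdecomp x, hx.1, hx.2]; simp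
  · conv_lhs => rw [← hdecomp x, map_add, map_smul, map_add, map_smul, add_comm]
    exact congrArg (· + _) (hker (T.restrict hT (π x)))

theorem hasEigenvalue_of_restrict {R V : Type*} [CommRing R] [AddCommGroup V] [Module R V]
    {T : End R V} {W : Submodule R V} (hT : ∀ x ∈ W, T x ∈ W) {ν : R}
    (hν : End.HasEigenvalue (T.restrict hT) ν) : T.HasEigenvalue ν := by
  obtain ⟨v, hv⟩ := hν.exists_hasEigenvector
  exact End.hasEigenvalue_of_hasEigenvector ⟨End.eigenspace_restrict_le_eigenspace T hT ν
    (Submodule.mem_map_of_mem hv.1), W.subtype_injective.ne hv.2⟩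

theorem exists_isStrictLyapunovForm_restrictScalars {V : Type*} [NormedAddCommGroup V]
    [NormedSpace ℂ V] [FiniteDimensional ℂ V] (T : V →L[ℂ] V)
    (hT : ∀ μ, End.HasEigenvalue (T : End ℂ V) μ → μ.re ≠ 0) :
    ∃ q, IsStrictLyapunovForm q (T.restrictScalars ℝ) ∧
      ((∀ μ, End.HasEigenvalue (T : End ℂ V) μ → μ.re < 0) → ∀ x, x ≠ 0 → 0 < q x x) := by
  induction hV : finrank ℂ V generalizing V with
  | zero =>
    have := finrank_zero_iff.1 hV
    exact ⟨0, ⟨fun _ _ => rfl, fun x hx => absurd (Subsingleton.elim x 0) hx⟩,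
      fun _ x hx => absurd (Subsingleton.elim x 0) hx⟩
  | succ N ih =>
    have : Nontrivial V := nontrivial_of_finrank_pos (R := ℂ) (by lia)
    obtain ⟨μ, hμ⟩ := End.exists_eigenvalue (T : End ℂ V)
    obtain ⟨ψ, hψ, hψT⟩ := exists_dual_comp_eq_mul hμ
    set φ := LinearMap.toContinuousLinearMap ψ
    have hφ : φ ≠ 0 := (LinearEquiv.map_ne_zero_iff _).2 hψ
    have hφT (x : V) : φ (T x) = μ * φ x := hψT x
    have hker (x : V) (hx : x ∈ φ.ker) : T x ∈ φ.ker :=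
      (hφT x).trans (by rw [show φ x = 0 from hx, mul_zero])
    obtain ⟨π, w, hne, hπT⟩ := exists_projection_ker hφ hker
    obtain ⟨q, hq, hqpos⟩ := ih (T.restrict hker)
      (fun ν hν => hT ν (hasEigenvalue_of_restrict hker hν))
      (Nat.succ.inj ((Dual.finrank_ker_add_one_of_ne_zero hψ).trans hV))
    obtain ⟨K, hK, hform⟩ := (isStrictLyapunovForm_mul (hT μ hμ)).exists_blockTriangular hq
      (L := T.restrictScalars ℝ) (π₁ := φ.restrictScalars ℝ) (π₂ := π.restrictScalars ℝ)
      (B := (ContinuousLinearMap.toSpanSingleton ℂ w).restrictScalars ℝ) hne hφT hπT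
    refine ⟨_, hform, fun hneg x hx => ?_⟩
    replace hqpos := hqpos fun ν hν => hneg ν (hasEigenvalue_of_restrict hker hν)
    have hμneg := neg_pos.2 (hneg μ hμ)
    change 0 < K * (-μ.re * inner ℝ (φ x) (φ x)) + q (π x) (π x)
    rw [real_inner_self_eq_norm_sq]
    rcases eq_or_ne (π x) 0 with h | h
    · have := norm_pos_iff.2 ((hne x hx).resolve_right (not_not.2 h))
      rw [h, map_zero, add_zero]
      positivity
    · exact add_pos_of_nonneg_of_pos (by positivity) (hqpos _ h)

end LyapunovForm

section Spectrum

open Matrix Polynomial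

variable {ι : Type} [Fintype ι] [DecidableEq ι]

theorem hasEigenvalue_toLin'_map_ofReal_iff {M : Matrix ι ι ℝ} {μ : ℂ} :
    End.HasEigenvalue (toLin' (M.map Complex.ofReal)) μ ↔ μ ∈ Sp M := by
  rw [End.hasEigenvalue_iff_mem_spectrum, spectrum_toLin', Sp]

theorem exists_mulVec_eq_smul_of_mem_Sp {M : Matrix ι ι ℝ} {μ : ℂ} (hμ : μ ∈ Sp M) :
    ∃ v ≠ 0, M.map Complex.ofReal *ᵥ v = μ • v := by
  obtain ⟨v, hv⟩ := (hasEigenvalue_toLin'_map_ofReal_iff.2 hμ).exists_hasEigenvector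
  exact ⟨v, hv.2, hv.apply_eq_smul⟩

theorem finite_Sp (M : Matrix ι ι ℝ) : (Sp M).Finite := Matrix.finite_spectrum _

theorem nonempty_Sp [Nonempty ι] (M : Matrix ι ι ℝ) : (Sp M).Nonempty :=
  spectrum.nonempty_of_isAlgClosed_of_finiteDimensional ℂ _

theorem Sp_aeval (M : Matrix ι ι ℝ) (P : ℝ[X]) :
    Sp (aeval M P) = (fun l : ℂ => aeval l P) '' Sp M := by
  have hmap : (aeval M P).map Complex.ofReal =
      aeval (M.map Complex.ofReal) (P.map (algebraMap ℝ ℂ)) := by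
    rw [aeval_map_algebraMap]
    exact (aeval_algHom_apply Complex.ofRealAm.mapMatrix M P).symm
  rcases isEmpty_or_nonempty ι
  · simp [Sp]
  · simp only [Sp, hmap]
    rw [spectrum.map_polynomial_aeval_of_nonempty _ _ (nonempty_Sp M)]
    simp

end Spectrum

section Linearization

open Matrix

variable {ι : Type} [Fintype ι] [DecidableEq ι] {E : Type*} [NormedAddCommGroup E]
  [NormedSpace ℝ E]

theorem exists_isStrictLyapunovForm [FiniteDimensional ℝ E] (b : Basis ι ℝ E) (L : E →L[ℝ] E)
    (hL : ∀ μ ∈ Sp (LinearMap.toMatrix b b L), μ.re ≠ 0) :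
    ∃ q, IsStrictLyapunovForm q L ∧
      ((∀ μ ∈ Sp (LinearMap.toMatrix b b L), μ.re < 0) → ∀ x, x ≠ 0 → 0 < q x x) := by
  set M := LinearMap.toMatrix b b L
  set T := LinearMap.toContinuousLinearMap (toLin' (M.map Complex.ofReal))
  have hT (μ : ℂ) : End.HasEigenvalue (T : End ℂ (ι → ℂ)) μ ↔ μ ∈ Sp M :=
    hasEigenvalue_toLin'_map_ofReal_iff
  obtain ⟨q, hq, hqpos⟩ := exists_isStrictLyapunovForm_restrictScalars T
    (fun μ hμ => hL μ ((hT μ).1 hμ))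
  let j : E →L[ℝ] ι → ℂ :=
    .pi fun i => Complex.ofRealCLM.comp (LinearMap.toContinuousLinearMap (b.coord i))
  have hj : Function.Injective j := fun x y h =>
    b.ext_elem fun i => Complex.ofReal_injective (congrFun h i)
  have hjL (x : E) : j (L x) = T (j x) := by
    ext i
    change Complex.ofRealHom (b.repr (L x) i) = _
    rw [← ContinuousLinearMap.coe_coe L, ← LinearMap.toMatrix_mulVec_repr b b]
    exact RingHom.map_mulVec Complex.ofRealHom M (b.repr x) i
  exact ⟨_, hq.comp hj hjL, fun h x hx =>
    hqpos (fun μ hμ => h μ ((hT μ).1 hμ)) _ ((map_ne_zero_iff j hj).2 hx)⟩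

theorem exists_invariant_pair_of_mem_Sp (b : Basis ι ℝ E) {L : E →ₗ[ℝ] E} {μ : ℂ}
    (hμ : μ ∈ Sp (LinearMap.toMatrix b b L)) :
    ∃ x y, (x ≠ 0 ∨ y ≠ 0) ∧ L x = μ.re • x - μ.im • y ∧ L y = μ.im • x + μ.re • y := by
  obtain ⟨v, hv, hMv⟩ := exists_mulVec_eq_smul_of_mem_Sp hμ
  have hL (w : ι → ℝ) (i : ι) :
      b.equivFun (L (b.equivFun.symm w)) i = (LinearMap.toMatrix b b L *ᵥ w) i := by
    conv_rhs => rw [← b.equivFun.apply_symm_apply w]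
    exact congrFun (LinearMap.toMatrix_mulVec_repr b b L _).symm i
  refine ⟨b.equivFun.symm fun i => (v i).re, b.equivFun.symm fun i => (v i).im, ?_,
    b.equivFun.injective (funext fun i => ?_), b.equivFun.injective (funext fun i => ?_)⟩
  · contrapose! hv
    simp only [LinearEquiv.map_eq_zero_iff] at hv
    exact funext fun i => Complex.ext (congrFun hv.1 i) (congrFun hv.2 i)
  · rw [hL]
    simpa [-Basis.equivFun_symm_apply, -Basis.equivFun_apply, mulVec, dotProduct]
      using congrArg Complex.re (congrFun hMv i)
  · rw [hL]
    simpa [-Basis.equivFun_symm_apply, -Basis.equivFun_apply, mulVec, dotProduct, add_comm]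
      using congrArg Complex.im (congrFun hMv i)

theorem IsStrictLyapunovForm.re_neg_of_mem_Sp {q : E →L[ℝ] E →L[ℝ] ℝ} {L : E →L[ℝ] E}
    (hq : IsStrictLyapunovForm q L) (hnonneg : ∀ x, 0 ≤ q x x) (b : Basis ι ℝ E) {μ : ℂ}
    (hμ : μ ∈ Sp (LinearMap.toMatrix b b L)) : μ.re < 0 := by
  obtain ⟨x, y, hxy, hx, hy⟩ := exists_invariant_pair_of_mem_Sp b hμ
  have hle (x : E) : q x (L x) ≤ 0 := by
    rcases eq_or_ne x 0 with rfl | h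
    · simp
    · exact (hq.apply_self_neg x h).le
  have hsum : q x (L x) + q y (L y) < 0 := by
    rcases hxy with h | h
    · exact add_neg_of_neg_of_nonpos (hq.apply_self_neg x h) (hle y)
    · exact add_neg_of_nonpos_of_neg (hle x) (hq.apply_self_neg y h)
  have hrotation : q x (L x) + q y (L y) = μ.re * (q x x + q y y) := by
    rw [show L x = _ from hx, show L y = _ from hy]
    simp only [map_sub, map_add, map_smul, smul_eq_mul, hq.symm y x]
    ring
  exact neg_of_mul_neg_left (hrotation ▸ hsum) (add_nonneg (hnonneg x) (hnonneg y))

theorem mem_Sp_toMatrix_add_smul_id_iff (b : Basis ι ℝ E) (L : E →L[ℝ] E) (η : ℝ) {μ : ℂ} :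
    μ ∈ Sp (LinearMap.toMatrix b b (L + η • .id ℝ E : E →L[ℝ] E)) ↔
      μ - η ∈ Sp (LinearMap.toMatrix b b L) := by
  have : LinearMap.toMatrix b b (L + η • .id ℝ E : E →L[ℝ] E) =
      Polynomial.aeval (LinearMap.toMatrix b b L) (.X + .C η) := by
    simp [Algebra.algebraMap_eq_smul_one]
  rw [this, Sp_aeval]
  simp [sub_eq_add_neg]

theorem convergesExponentially_iff [FiniteDimensional ℝ E] (b : Basis ι ℝ E) {V : E → E} {p : E}
    (hV : ContDiff ℝ 1 V) (hp : V p = 0) :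
    ConvergesExponentially V p ↔
      ∀ μ ∈ Sp (LinearMap.toMatrix b b (fderiv ℝ V p)), μ.re < 0 := by
  set L := fderiv ℝ V p
  refine ⟨fun h μ hμ => ?_, fun h => ?_⟩
  · obtain ⟨c, hc, hnonneg⟩ :=
      h.exists_apply_self_nonneg (hV.differentiable one_ne_zero p).hasFDerivAt hp
    obtain ⟨η, ⟨hη, hηc⟩, hηSp⟩ := (Ioo_infinite hc).exists_notMem_finite
      ((finite_Sp (LinearMap.toMatrix b b L)).image fun ν => -ν.re)
    obtain ⟨q, hq, -⟩ := exists_isStrictLyapunovForm b (L + η • .id ℝ E) fun ν hν h0 =>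
      hηSp ⟨ν - η, (mem_Sp_toMatrix_add_smul_id_iff b L η).1 hν, by simp [h0]⟩
    have := hq.re_neg_of_mem_Sp (hnonneg η hηc q hq) b (μ := μ + η)
      ((mem_Sp_toMatrix_add_smul_id_iff b L η).2 (by simpa using hμ))
    simp only [Complex.add_re, Complex.ofReal_re] at this
    linarith
  · obtain ⟨q, hq, hpos⟩ := exists_isStrictLyapunovForm b L fun μ hμ => (h μ hμ).ne
    exact hq.convergesExponentially (hpos h) hV hp

end Linearization

section SecondOrder

open Matrix

variable {E : Type*} [NormedAddCommGroup E] [NormedSpace ℝ E]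

theorem deriv_deriv_nonneg_of_isLocalMin {φ : ℝ → ℝ} {t : ℝ} (hc : ContinuousAt φ t)
    (h : IsLocalMin φ t) : 0 ≤ deriv (deriv φ) t := by
  by_contra! hneg
  have hmax := isLocalMax_of_deriv_deriv_neg hneg h.deriv_eq_zero hc
  have hconst : φ =ᶠ[𝓝 t] fun _ => φ t := by
    filter_upwards [h, hmax] with s h1 h2 using le_antisymm h2 h1
  simp [hconst.deriv.deriv_eq] at hneg

theorem deriv_deriv_add_smul {g : E → ℝ} (hg : ContDiff ℝ 2 g) (p w : E) :
    deriv (deriv fun t : ℝ => g (p + t • w)) 0 = fderiv ℝ (fderiv ℝ g) p w w := by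
  have hline (t : ℝ) : HasDerivAt (fun t : ℝ => p + t • w) w t := by
    simpa using ((hasDerivAt_id t).smul_const w).const_add p
  have hderiv : (deriv fun t : ℝ => g (p + t • w)) = fun t => fderiv ℝ g (p + t • w) w :=
    funext fun t =>
      ((hg.differentiable two_ne_zero _).hasFDerivAt.comp_hasDerivAt t (hline t)).deriv
  have hg' : HasFDerivAt (fderiv ℝ g) (fderiv ℝ (fderiv ℝ g) p) (p + (0 : ℝ) • w) := by
    rw [zero_smul, add_zero]
    exact ((hg.fderiv_right (m := 1) le_rfl).differentiable one_ne_zero p).hasFDerivAt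
  have hcomp : HasDerivAt (fun t : ℝ => fderiv ℝ g (p + t • w))
      (fderiv ℝ (fderiv ℝ g) p w) 0 := hg'.comp_hasDerivAt 0 (hline 0)
  have happly := hcomp.clm_apply (hasDerivAt_const (0 : ℝ) w)
  rw [hderiv, happly.deriv]
  simp

theorem fderiv_fderiv_nonneg_of_isLocalMin {g : E → ℝ} (hg : ContDiff ℝ 2 g) {p w : E}
    (h : IsLocalMin (fun t : ℝ => g (p + t • w)) 0) : 0 ≤ fderiv ℝ (fderiv ℝ g) p w w := by
  rw [← deriv_deriv_add_smul hg]
  have hcont : Continuous fun t : ℝ => g (p + t • w) := hg.continuous.comp (by fun_prop)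
  exact deriv_deriv_nonneg_of_isLocalMin hcont.continuousAt h

theorem fderiv_fderiv_nonpos_of_isLocalMax {g : E → ℝ} (hg : ContDiff ℝ 2 g) {p w : E}
    (h : IsLocalMax (fun t : ℝ => g (p + t • w)) 0) : fderiv ℝ (fderiv ℝ g) p w w ≤ 0 := by
  have hneg : fderiv ℝ (fun z => -g z) = fun z => -fderiv ℝ g z := funext fun z => fderiv_neg
  simpa [hneg] using fderiv_fderiv_nonneg_of_isLocalMin hg.neg h.neg

theorem posSemidef_of_apply_nonneg {κ : Type*} [Finite κ] {B : E →L[ℝ] E →L[ℝ] ℝ}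
    (hsymm : ∀ x y, B x y = B y x) (hB : ∀ x, 0 ≤ B x x) (v : κ → E) :
    (Matrix.of fun i j => B (v i) (v j)).PosSemidef := by
  have := Fintype.ofFinite κ
  refine Matrix.PosSemidef.of_dotProduct_mulVec_nonneg (by ext i j; simp [hsymm (v i)]) fun x => ?_
  have hsum : star x ⬝ᵥ (Matrix.of fun i j => B (v i) (v j)) *ᵥ x =
      B (∑ i, x i • v i) (∑ j, x j • v j) := by
    simp only [dotProduct, mulVec, of_apply, Finset.mul_sum, map_sum, map_smul, star_trivial,
      FunLike.coe_sum, Finset.sum_apply, _root_.smul_apply, smul_eq_mul]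
    exact Finset.sum_congr rfl fun i _ => Finset.sum_congr rfl fun j _ => by
      rw [hsymm (v i)]; ring
  exact hsum ▸ hB _

end SecondOrder

section Dissipation

open Matrix
open scoped ComplexOrder MatrixOrder

variable {ι : Type} [Fintype ι]

theorem posSemidef_map_ofReal {κ : Type*} [Finite κ] {P : Matrix κ κ ℝ} (hP : P.PosSemidef) :
    (P.map Complex.ofReal).PosSemidef := by
  classical
  have := Fintype.ofFinite κ
  obtain ⟨B, rfl⟩ := CStarAlgebra.nonneg_iff_eq_star_mul_self.1 hP.nonneg
  have hmap : (star B * B).map Complex.ofReal =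
      (B.map Complex.ofReal)ᴴ * B.map Complex.ofReal := by
    rw [← conjTranspose_map _ fun x => (Complex.conj_ofReal x).symm]
    exact map_mul (Complex.ofRealHom.mapMatrix) (star B) B
  exact hmap ▸ posSemidef_conjTranspose_mul_self _

theorem re_star_dotProduct_mulVec_eq_zero {A : Matrix ι ι ℂ} (hA : Aᴴ = -A) (v : ι → ℂ) :
    (star v ⬝ᵥ A *ᵥ v).re = 0 := by
  have hconj : star (star v ⬝ᵥ A *ᵥ v) = -(star v ⬝ᵥ A *ᵥ v) := by
    rw [← star_dotProduct_star, star_star, star_mulVec, hA, ← dotProduct_mulVec, neg_mulVec,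
      dotProduct_neg]
  exact self_eq_neg.1 (congrArg Complex.re hconj)

theorem mulVec_eq_zero_of_re_nonneg {S A : Matrix ι ι ℂ} (hS : (-S).PosSemidef) (hA : Aᴴ = -A)
    {μ : ℂ} (hμ : 0 ≤ μ.re) {v : ι → ℂ} (hv : (S + A) *ᵥ v = μ • v) : S *ᵥ v = 0 := by
  obtain ⟨hvre, hvim⟩ := Complex.nonneg_iff.1 (dotProduct_star_self_nonneg v)
  obtain ⟨hSre, hSim⟩ := Complex.nonneg_iff.1 (hS.dotProduct_mulVec_nonneg v)
  have hre : (star v ⬝ᵥ S *ᵥ v).re = μ.re * (star v ⬝ᵥ v).re := by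
    have := congrArg (fun w => (star v ⬝ᵥ w).re) hv
    simpa [add_mulVec, re_star_dotProduct_mulVec_eq_zero hA, ← hvim] using this
  have hzero : star v ⬝ᵥ (-S) *ᵥ v = 0 := by
    refine Complex.ext (le_antisymm ?_ hSre) hSim.symm
    simpa [neg_mulVec, hre] using mul_nonneg hμ hvre
  simpa [neg_mulVec] using (hS.dotProduct_mulVec_zero_iff v).1 hzero

theorem re_neg_of_mem_Sp_add [DecidableEq ι] {S A : Matrix ι ι ℝ} (hS : (-S).PosSemidef)
    (hA : Aᵀ = -A) (hker : EigVec A ∩ Ker S ⊆ {0}) {μ : ℂ} (hμ : μ ∈ Sp (S + A)) : μ.re < 0 := by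
  obtain ⟨v, hv, hSA⟩ := exists_mulVec_eq_smul_of_mem_Sp hμ
  by_contra! hre
  rw [Matrix.map_add _ Complex.ofReal_add] at hSA
  have hSv : S.map Complex.ofReal *ᵥ v = 0 := by
    refine mulVec_eq_zero_of_re_nonneg ?_ ?_ hre hSA
    · rw [← Matrix.map_neg _ Complex.ofReal_neg]
      exact posSemidef_map_ofReal hS
    · rw [← conjTranspose_map _ fun x => (Complex.conj_ofReal x).symm,
        conjTranspose_eq_transpose_of_trivial, hA, Matrix.map_neg _ Complex.ofReal_neg]
  rw [add_mulVec, hSv, zero_add] at hSA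
  exact hv (hker ⟨⟨μ, hSA⟩, hSv⟩)

end Dissipation

open Matrix Polynomial

variable {n m : ℕ} {f : Strat n m → ℝ} {p : Strat n m}

/-- The standard basis of `ℝⁿ × ℝᵐ`, indexed like the blocks of `𝒥`. -/
noncomputable def stratBasis (n m : ℕ) : Basis (Fin n ⊕ Fin m) ℝ (Strat n m) :=
  (EuclideanSpace.basisFun (Fin n) ℝ).toBasis.prod (EuclideanSpace.basisFun (Fin m) ℝ).toBasis

@[simp] theorem stratBasis_inl (i : Fin n) :
    stratBasis n m (.inl i) = (EuclideanSpace.single i 1, 0) := by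
  simp [stratBasis]

@[simp] theorem stratBasis_inr (i : Fin m) :
    stratBasis n m (.inr i) = (0, EuclideanSpace.single i 1) := by
  simp [stratBasis]

@[simp] theorem stratBasis_repr_inl (z : Strat n m) (i : Fin n) :
    (stratBasis n m).repr z (.inl i) = z.1 i := by
  simp [stratBasis]

@[simp] theorem stratBasis_repr_inr (z : Strat n m) (i : Fin m) :
    (stratBasis n m).repr z (.inr i) = z.2 i := by
  simp [stratBasis]

/-- The sign with which each coordinate enters gradient descent-ascent: the minimizing player
descends, the maximizing one ascends. -/
noncomputable def playerSign (n m : ℕ) : Fin n ⊕ Fin m → ℝ := Sum.elim (fun _ => -1) fun _ => 1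

/-- The linear map taking the differential of `f` to the descent-ascent direction
`(-∇ₓ f, ∇_y f)`. -/
noncomputable def descentAscent (n m : ℕ) : (Strat n m →L[ℝ] ℝ) →L[ℝ] Strat n m :=
  ∑ k, (ContinuousLinearMap.apply ℝ ℝ (stratBasis n m k)).smulRight
    (playerSign n m k • stratBasis n m k)

theorem stratBasis_repr_descentAscent (l : Strat n m →L[ℝ] ℝ) (k : Fin n ⊕ Fin m) :
    (stratBasis n m).repr (descentAscent n m l) k = playerSign n m k * l (stratBasis n m k) := by
  simp [descentAscent, Finsupp.single_apply, mul_comm, -Fintype.sum_sum_type]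

theorem apply_descentAscent (l l' : Strat n m →L[ℝ] ℝ) :
    l (descentAscent n m l') =
      ∑ k, playerSign n m k * (l (stratBasis n m k) * l' (stratBasis n m k)) := by
  simp [descentAscent, mul_comm, mul_left_comm, -Fintype.sum_sum_type]

theorem apply_descentAscent_comm (l l' : Strat n m →L[ℝ] ℝ) :
    l (descentAscent n m l') = l' (descentAscent n m l) := by
  simp only [apply_descentAscent, mul_comm]

/-- The gradient descent-ascent field `(-∇ₓ f, ∇_y f)`. -/
noncomputable def gda (f : Strat n m → ℝ) (z : Strat n m) : Strat n m := (-gradX f z, gradY f z)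

theorem gradX_apply (hf : DifferentiableAt ℝ f p) (i : Fin n) :
    gradX f p i = fderiv ℝ f p (EuclideanSpace.single i 1, 0) := by
  have hcomp : HasFDerivAt (fun x => f (x, p.2)) _ p.1 :=
    hf.hasFDerivAt.comp p.1 (hasFDerivAt_prodMk_left p.1 p.2)
  have hinner : inner ℝ (gradX f p) (EuclideanSpace.single i 1) =
      fderiv ℝ f p (EuclideanSpace.single i 1, 0) := by
    rw [gradX, gradient, hcomp.fderiv, InnerProductSpace.toDual_symm_apply]
    rfl
  simpa [EuclideanSpace.inner_single_right] using hinner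

theorem gradY_apply (hf : DifferentiableAt ℝ f p) (i : Fin m) :
    gradY f p i = fderiv ℝ f p (0, EuclideanSpace.single i 1) := by
  have hcomp : HasFDerivAt (fun y => f (p.1, y)) _ p.2 :=
    hf.hasFDerivAt.comp p.2 (hasFDerivAt_prodMk_right p.1 p.2)
  have hinner : inner ℝ (gradY f p) (EuclideanSpace.single i 1) =
      fderiv ℝ f p (0, EuclideanSpace.single i 1) := by
    rw [gradY, gradient, hcomp.fderiv, InnerProductSpace.toDual_symm_apply]
    rfl
  simpa [EuclideanSpace.inner_single_right] using hinner

theorem gda_eq_descentAscent (hf : DifferentiableAt ℝ f p) :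
    gda f p = descentAscent n m (fderiv ℝ f p) := by
  refine (stratBasis n m).ext_elem fun k => ?_
  rw [stratBasis_repr_descentAscent]
  cases k <;> simp [gda, playerSign, gradX_apply hf, gradY_apply hf]

theorem fderiv_apply_gda (hf : DifferentiableAt ℝ f p) :
    fderiv ℝ f p (gda f p) = ‖gradY f p‖ ^ 2 - ‖gradX f p‖ ^ 2 := by
  rw [gda_eq_descentAscent hf, apply_descentAscent, EuclideanSpace.real_norm_sq_eq,
    EuclideanSpace.real_norm_sq_eq]
  simp only [playerSign, Fintype.sum_sum_type, Sum.elim_inl, Sum.elim_inr, stratBasis_inl,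
    stratBasis_inr, neg_mul, one_mul, Finset.sum_neg_distrib, gradX_apply hf, gradY_apply hf,
    pow_two]
  ring

theorem hasFDerivAt_fderiv (hf : ContDiff ℝ 2 f) (z : Strat n m) :
    HasFDerivAt (fderiv ℝ f) (fderiv ℝ (fderiv ℝ f) z) z :=
  ((hf.fderiv_right (m := 1) le_rfl).differentiable one_ne_zero z).hasFDerivAt

theorem fderiv_fderiv_apply_comm (hf : ContDiff ℝ 2 f) (z u v : Strat n m) :
    fderiv ℝ (fderiv ℝ f) z u v = fderiv ℝ (fderiv ℝ f) z v u :=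
  hf.contDiffAt.isSymmSndFDerivAt (by simp) u v

theorem gda_eq_comp (hf : Differentiable ℝ f) : gda f = descentAscent n m ∘ fderiv ℝ f :=
  funext fun z => gda_eq_descentAscent (hf z)

theorem hasFDerivAt_gda (hf : ContDiff ℝ 2 f) (z : Strat n m) :
    HasFDerivAt (gda f) (descentAscent n m ∘L fderiv ℝ (fderiv ℝ f) z) z := by
  rw [gda_eq_comp (hf.differentiable two_ne_zero)]
  exact (descentAscent n m).hasFDerivAt.comp z (hasFDerivAt_fderiv hf z)

theorem contDiff_gda {k : ℕ} (hf : ContDiff ℝ (k + 1) f) : ContDiff ℝ k (gda f) := by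
  rw [gda_eq_comp (hf.differentiable (by simp))]
  exact (descentAscent n m).contDiff.comp (hf.fderiv_right le_rfl)

theorem hasFDerivAt_modifiedLoss (hf : ContDiff ℝ 2 f) (β h : ℝ) (z : Strat n m) :
    HasFDerivAt (modifiedLoss β h f) ((1 / (1 - β)) • fderiv ℝ f z -
      (h * (1 + β) / (2 * (1 - β) ^ 3)) • fderiv ℝ (fderiv ℝ f) z (gda f z)) z := by
  have hdiff := hf.differentiable two_ne_zero
  have hloss : modifiedLoss β h f = fun z => 1 / (1 - β) * f z -
      h * (1 + β) / (4 * (1 - β) ^ 3) * fderiv ℝ f z (gda f z) := by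
    funext w
    rw [fderiv_apply_gda (hdiff w), modifiedLoss]
    ring
  have hpair := (hasFDerivAt_fderiv hf z).clm_apply (hasFDerivAt_gda hf z)
  rw [hloss]
  refine (((hdiff z).hasFDerivAt.const_mul _).sub (hpair.const_mul _)).congr_fderiv ?_
  refine ContinuousLinearMap.ext fun u => ?_
  have hsymm : fderiv ℝ f z (descentAscent n m (fderiv ℝ (fderiv ℝ f) z u)) =
      fderiv ℝ (fderiv ℝ f) z (gda f z) u := by
    rw [apply_descentAscent_comm, ← gda_eq_descentAscent (hdiff z), fderiv_fderiv_apply_comm hf]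
  simp only [_root_.sub_apply, _root_.smul_apply, _root_.add_apply, ContinuousLinearMap.comp_apply,
    ContinuousLinearMap.flip_apply, smul_eq_mul, hsymm, fderiv_fderiv_apply_comm hf z u]
  generalize (1 - β) ^ 3 = d
  ring

theorem simHBField_eq (hf : ContDiff ℝ 2 f) (β h : ℝ) :
    simHBField β h f = fun z => (1 / (1 - β)) • gda f z -
      (h * (1 + β) / (2 * (1 - β) ^ 3)) • fderiv ℝ (gda f) z (gda f z) := by
  funext z
  have hloss := hasFDerivAt_modifiedLoss hf β h z
  change gda (modifiedLoss β h f) z = _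
  rw [gda_eq_descentAscent hloss.differentiableAt, hloss.fderiv, (hasFDerivAt_gda hf z).fderiv,
    map_sub, map_smul, map_smul, ← gda_eq_descentAscent (hf.differentiable two_ne_zero z)]
  rfl

theorem contDiff_simHBField (hf : ContDiff ℝ 3 f) (β h : ℝ) : ContDiff ℝ 1 (simHBField β h f) := by
  have hgda : ContDiff ℝ 2 (gda f) := contDiff_gda (k := 2) hf
  have hgda' : ContDiff ℝ 1 (gda f) := hgda.of_le one_le_two
  rw [simHBField_eq (hf.of_le (by norm_num))]
  exact (hgda'.const_smul _).sub
    (((hgda.fderiv_right (m := 1) le_rfl).clm_apply hgda').const_smul _)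

theorem fderiv_prodMk_left {G : Type*} [NormedAddCommGroup G] [NormedSpace ℝ G]
    {g : Strat n m → G} (hg : DifferentiableAt ℝ g p) (u : EuclideanSpace ℝ (Fin n)) :
    fderiv ℝ (fun x => g (x, p.2)) p.1 u = fderiv ℝ g p (u, 0) := by
  have h : HasFDerivAt (fun x => g (x, p.2)) _ p.1 :=
    hg.hasFDerivAt.comp p.1 (hasFDerivAt_prodMk_left p.1 p.2)
  rw [h.fderiv]
  rfl

theorem fderiv_prodMk_right {G : Type*} [NormedAddCommGroup G] [NormedSpace ℝ G]
    {g : Strat n m → G} (hg : DifferentiableAt ℝ g p) (u : EuclideanSpace ℝ (Fin m)) :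
    fderiv ℝ (fun y => g (p.1, y)) p.2 u = fderiv ℝ g p (0, u) := by
  have h : HasFDerivAt (fun y => g (p.1, y)) _ p.2 :=
    hg.hasFDerivAt.comp p.2 (hasFDerivAt_prodMk_right p.1 p.2)
  rw [h.fderiv]
  rfl

theorem toMatrix_fderiv_gda (hf : DifferentiableAt ℝ (gda f) p) :
    LinearMap.toMatrix (stratBasis n m) (stratBasis n m) (fderiv ℝ (gda f) p) = jac f p := by
  have hX : DifferentiableAt ℝ (gradX f) p := by simpa [gda] using hf.fst.neg
  have hY : DifferentiableAt ℝ (gradY f) p := hf.snd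
  have hgda (u : Strat n m) :
      fderiv ℝ (gda f) p u = (-fderiv ℝ (gradX f) p u, fderiv ℝ (gradY f) p u) :=
    congrArg (· u) (hX.hasFDerivAt.neg.prodMk hY.hasFDerivAt).fderiv
  ext (i | i) (j | j) <;>
    simp [LinearMap.toMatrix_apply, hgda, jac, hessXX, hessXY, hessYX, hessYY,
      fderiv_prodMk_left hX, fderiv_prodMk_left hY, fderiv_prodMk_right hX, fderiv_prodMk_right hY]

theorem jac_apply (hf : ContDiff ℝ 2 f) (i j : Fin n ⊕ Fin m) :
    jac f p i j = playerSign n m i *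
      fderiv ℝ (fderiv ℝ f) p (stratBasis n m j) (stratBasis n m i) := by
  have hgda := hasFDerivAt_gda hf p
  rw [← toMatrix_fderiv_gda hgda.differentiableAt, LinearMap.toMatrix_apply, hgda.fderiv]
  exact stratBasis_repr_descentAscent _ i

theorem hamiltonianPart_transpose (hf : ContDiff ℝ 2 f) :
    (hamiltonianPart f p)ᵀ = -hamiltonianPart f p := by
  have hXY (i : Fin n) (j : Fin m) : hessYX f p j i = hessXY f p i j := by
    have hjac₁ : -hessXY f p i j = _ := jac_apply hf (.inl i) (.inr j)
    have hjac₂ : hessYX f p j i = _ := jac_apply hf (.inr j) (.inl i)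
    rw [hjac₂, ← neg_neg (hessXY f p i j), hjac₁, fderiv_fderiv_apply_comm hf]
    simp [playerSign]
  ext (i | i) (j | j) <;> simp [hamiltonianPart, hXY]

theorem IsLocalNash.fderiv_fderiv_nonneg (hp : IsLocalNash f p) (hf : ContDiff ℝ 2 f)
    (u : EuclideanSpace ℝ (Fin n)) : 0 ≤ fderiv ℝ (fderiv ℝ f) p (u, 0) (u, 0) := by
  have hline (t : ℝ) : p + t • ((u, 0) : Strat n m) = (p.1 + t • u, p.2) := by ext <;> simp
  refine fderiv_fderiv_nonneg_of_isLocalMin hf ?_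
  simp only [hline]
  exact IsLocalMin.comp_continuous (g := fun t : ℝ => p.1 + t • u) (b := 0)
    (by simpa using hp.1) (by fun_prop)

theorem IsLocalNash.fderiv_fderiv_nonpos (hp : IsLocalNash f p) (hf : ContDiff ℝ 2 f)
    (u : EuclideanSpace ℝ (Fin m)) : fderiv ℝ (fderiv ℝ f) p (0, u) (0, u) ≤ 0 := by
  have hline (t : ℝ) : p + t • ((0, u) : Strat n m) = (p.1, p.2 + t • u) := by ext <;> simp
  refine fderiv_fderiv_nonpos_of_isLocalMax hf ?_
  simp only [hline]
  exact IsLocalMax.comp_continuous (g := fun t : ℝ => p.2 + t • u) (b := 0)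
    (by simpa using hp.2) (by fun_prop)

theorem IsLocalNash.posSemidef_neg_potentialPart (hp : IsLocalNash f p) (hf : ContDiff ℝ 2 f) :
    (-potentialPart f p).PosSemidef := by
  set D := fderiv ℝ (fderiv ℝ f) p
  have hD : ∀ u v, D u v = D v u := fderiv_fderiv_apply_comm hf p
  let toX : Strat n m →L[ℝ] Strat n m := .prodMap (.id ℝ _) 0
  let toY : Strat n m →L[ℝ] Strat n m := .prodMap 0 (.id ℝ _)
  have hnonneg (z : Strat n m) :
      0 ≤ (D.bilinearComp toX toX - D.bilinearComp toY toY) z z :=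
    sub_nonneg.2 ((hp.fderiv_fderiv_nonpos hf z.2).trans (hp.fderiv_fderiv_nonneg hf z.1))
  suffices hgram : -potentialPart f p = Matrix.of fun i j =>
      (D.bilinearComp toX toX - D.bilinearComp toY toY) (stratBasis n m i) (stratBasis n m j) from
    hgram ▸ posSemidef_of_apply_nonneg (fun u v => congrArg₂ (· - ·) (hD _ _) (hD _ _)) hnonneg
      (stratBasis n m)
  have hzero : ((0, 0) : Strat n m) = 0 := rfl
  ext (i | i) (j | j)
  · have hjac : -hessXX f p i j = _ := jac_apply hf (.inl i) (.inl j)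
    simpa [potentialPart, playerSign, toX, toY, hzero, D, hD (EuclideanSpace.single j 1, 0)]
      using hjac
  · simp [potentialPart, toX, toY, hzero]
  · simp [potentialPart, toX, toY, hzero]
  · have hjac : hessYY f p i j = _ := jac_apply hf (.inr i) (.inr j)
    simpa [potentialPart, playerSign, toX, toY, hzero, D, hD (0, EuclideanSpace.single j 1)]
      using hjac

theorem IsLocalNash.gda_eq_zero (hp : IsLocalNash f p) : gda f p = 0 := by
  simp [gda, gradX, gradY, gradient, hp.1.fderiv_eq_zero, hp.2.fderiv_eq_zero]

theorem jac_eq_add : jac f p = potentialPart f p + hamiltonianPart f p := by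
  simp [jac, potentialPart, hamiltonianPart, fromBlocks_add]

theorem IsLocalNash.re_neg_of_mem_Sp_jac (hp : IsLocalNash f p) (hf : ContDiff ℝ 2 f)
    (hker : EigKerTrivial f p) {l : ℂ} (hl : l ∈ Sp (jac f p)) : l.re < 0 :=
  re_neg_of_mem_Sp_add (hp.posSemidef_neg_potentialPart hf) (hamiltonianPart_transpose hf)
    hker.subset (jac_eq_add ▸ hl)

theorem IsLocalNash.simHBField_eq_zero (hp : IsLocalNash f p) (hf : ContDiff ℝ 2 f) (β h : ℝ) :
    simHBField β h f p = 0 := by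
  simp [simHBField_eq hf, hp.gda_eq_zero]

/-- The polynomial sending `𝒥` to the linearization of Continuous Sim-HB. -/
noncomputable def simHBPolynomial (β h : ℝ) : ℝ[X] :=
  (1 / (1 - β)) • X - (h * (1 + β) / (2 * (1 - β) ^ 3)) • X ^ 2

theorem IsLocalNash.toMatrix_fderiv_simHBField (hp : IsLocalNash f p) (hf : ContDiff ℝ 3 f)
    (β h : ℝ) :
    LinearMap.toMatrix (stratBasis n m) (stratBasis n m) (fderiv ℝ (simHBField β h f) p) =
      aeval (jac f p) (simHBPolynomial β h) := by
  have hgda : ContDiff ℝ 2 (gda f) := contDiff_gda (k := 2) hf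
  have hgda₁ := (hgda.differentiable two_ne_zero p).hasFDerivAt
  have hgda₂ := ((hgda.fderiv_right (m := 1) le_rfl).differentiable one_ne_zero p).hasFDerivAt
  have hfield : HasFDerivAt (simHBField β h f) ((1 / (1 - β)) • fderiv ℝ (gda f) p -
      (h * (1 + β) / (2 * (1 - β) ^ 3)) • (fderiv ℝ (gda f) p ∘L fderiv ℝ (gda f) p)) p := by
    rw [simHBField_eq (hf.of_le (by norm_num))]
    refine ((hgda₁.const_smul (1 / (1 - β))).sub ((hgda₂.clm_apply hgda₁).const_smul
      (h * (1 + β) / (2 * (1 - β) ^ 3)))).congr_fderiv ?_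
    simp [hp.gda_eq_zero]
  have hpoly : (fderiv ℝ (simHBField β h f) p : Strat n m →ₗ[ℝ] Strat n m) =
      aeval (fderiv ℝ (gda f) p : Strat n m →ₗ[ℝ] Strat n m) (simHBPolynomial β h) := by
    simp only [simHBPolynomial, hfield.fderiv, map_sub, map_smul, map_pow, aeval_X]
    rw [pow_two]
    rfl
  rw [hpoly, ← toMatrix_fderiv_gda hgda₁.differentiableAt]
  exact (aeval_algHom_apply (LinearMap.toMatrixAlgEquiv (stratBasis n m)) _ _).symm

theorem strictAntiOn_momentumFactor : StrictAntiOn momentumFactor (Ioo (-1) 1) := by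
  intro a ha b hb hab
  have ha' : 0 < 1 + a := by linarith [ha.1]
  have hb' : 0 < 1 - b := by linarith [hb.2]
  have hsq : (1 - b) ^ 2 < (1 - a) ^ 2 := by gcongr
  unfold momentumFactor
  gcongr

theorem momentumFactor_pos {β : ℝ} (hβ : β ∈ Ioo (-1 : ℝ) 1) : 0 < momentumFactor β := by
  have h1 : 0 < 1 + β := by linarith [hβ.1]
  have h2 : 0 < 1 - β := by linarith [hβ.2]
  unfold momentumFactor
  positivity

theorem re_aeval_simHBPolynomial (β h : ℝ) (l : ℂ) :
    (aeval l (simHBPolynomial β h)).re =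
      1 / (1 - β) * l.re - h * (1 + β) / (2 * (1 - β) ^ 3) * (l.re ^ 2 - l.im ^ 2) := by
  rw [simHBPolynomial, map_sub, map_smul, map_smul, map_pow, aeval_X, Complex.sub_re,
    Complex.smul_re, Complex.smul_re, pow_two, Complex.mul_re]
  simp only [smul_eq_mul]
  ring

theorem re_aeval_simHBPolynomial_neg_iff {β : ℝ} (hβ : β ∈ Ioo (-1 : ℝ) 1) (h : ℝ) {l : ℂ}
    (hre : l.re < 0) (him : |l.re| < |l.im|) :
    (aeval l (simHBPolynomial β h)).re < 0 ↔
      h < momentumFactor β * (|l.re| / (l.im ^ 2 - l.re ^ 2)) := by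
  have h1 : 0 < 1 + β := by linarith [hβ.1]
  have h2 : 0 < 1 - β := by linarith [hβ.2]
  have hgap : 0 < l.im ^ 2 - l.re ^ 2 := sub_pos.2 (sq_lt_sq.2 him)
  rw [re_aeval_simHBPolynomial, abs_of_neg hre, momentumFactor, div_mul_div_comm,
    lt_div_iff₀ (mul_pos h1 hgap)]
  generalize l.im = y at hgap ⊢
  generalize l.re = x at hgap ⊢
  have hscale : 1 / (1 - β) * x - h * (1 + β) / (2 * (1 - β) ^ 3) * (x ^ 2 - y ^ 2) =
      (h * ((1 + β) * (y ^ 2 - x ^ 2)) - 2 * (1 - β) ^ 2 * -x) / (2 * (1 - β) ^ 3) := by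
    field_simp
    ring
  rw [hscale, div_lt_iff₀ (by positivity), zero_mul, sub_neg]

theorem lt_stepBound_iff [Nonempty (Fin n ⊕ Fin m)] {β h : ℝ} : h < stepBound f p β ↔
    ∀ l ∈ Sp (jac f p), h < momentumFactor β * (|l.re| / (l.im ^ 2 - l.re ^ 2)) := by
  rw [stepBound, ((finite_Sp (jac f p)).image _).lt_csInf_iff ((nonempty_Sp (jac f p)).image _),
    forall_mem_image]

theorem stepBound_le {β : ℝ} {l : ℂ} (hl : l ∈ Sp (jac f p)) :
    stepBound f p β ≤ momentumFactor β * (|l.re| / (l.im ^ 2 - l.re ^ 2)) :=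
  csInf_le ((finite_Sp (jac f p)).image _).bddBelow ⟨l, hl, rfl⟩

section StepSizes

variable (hp : IsLocalNash f p) (hdom : InteractionDominates f p) (hker : EigKerTrivial f p)

include hp hdom hker

theorem div_sq_sub_sq_pos (hf : ContDiff ℝ 2 f) {l : ℂ} (hl : l ∈ Sp (jac f p)) :
    0 < |l.re| / (l.im ^ 2 - l.re ^ 2) :=
  div_pos (abs_pos.2 (hp.re_neg_of_mem_Sp_jac hf hker hl).ne) (sub_pos.2 (sq_lt_sq.2 (hdom l hl)))

theorem stepBound_pos [Nonempty (Fin n ⊕ Fin m)] (hf : ContDiff ℝ 2 f) {β : ℝ}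
    (hβ : β ∈ Ioo (-1 : ℝ) 1) : 0 < stepBound f p β :=
  lt_stepBound_iff.2 fun _ hl =>
    mul_pos (momentumFactor_pos hβ) (div_sq_sub_sq_pos hp hdom hker hf hl)

theorem strictAntiOn_stepBound [Nonempty (Fin n ⊕ Fin m)] (hf : ContDiff ℝ 2 f) :
    StrictAntiOn (stepBound f p) (Ioo (-1) 1) := fun _ h₁ _ h₂ h =>
  lt_stepBound_iff.2 fun _ hl => (stepBound_le hl).trans_lt <|
    mul_lt_mul_of_pos_right (strictAntiOn_momentumFactor h₁ h₂ h)
      (div_sq_sub_sq_pos hp hdom hker hf hl)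

theorem convergentSteps_eq [Nonempty (Fin n ⊕ Fin m)] (hf : ContDiff ℝ 3 f) {β : ℝ}
    (hβ : β ∈ Ioo (-1 : ℝ) 1) : convergentSteps f p β = Ioo 0 (stepBound f p β) := by
  have hf₂ : ContDiff ℝ 2 f := hf.of_le (by norm_num)
  ext h
  refine and_congr_right fun _ => ?_
  change ConvergesExponentially (simHBField β h f) p ↔ _
  rw [convergesExponentially_iff (stratBasis n m) (contDiff_simHBField hf β h)
    (hp.simHBField_eq_zero hf₂ β h), hp.toMatrix_fderiv_simHBField hf, Sp_aeval, forall_mem_image,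
    lt_stepBound_iff]
  exact forall₂_congr fun l hl =>
    re_aeval_simHBPolynomial_neg_iff hβ h (hp.re_neg_of_mem_Sp_jac hf₂ hker hl) (hdom l hl)

end StepSizes

end MinMaxHB

theorem corollary4p7_general {n m : ℕ} (hnm : 0 < n + m) {f : MinMaxHB.Strat n m → ℝ}
    {p : MinMaxHB.Strat n m} (hf : ContDiff ℝ 3 f) (hp : MinMaxHB.IsLocalNash f p)
    (hdom : MinMaxHB.InteractionDominates f p) (hker : MinMaxHB.EigKerTrivial f p) :
    (∀ β ∈ Set.Ioo (-1 : ℝ) 1,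
      0 < MinMaxHB.stepBound f p β ∧
      Set.Ioo 0 (MinMaxHB.stepBound f p β) = MinMaxHB.convergentSteps f p β) ∧
    (∀ β₁ ∈ Set.Ioo (-1 : ℝ) 1, ∀ β₂ ∈ Set.Ioo (-1 : ℝ) 1, β₁ < β₂ →
      Set.Ioo 0 (MinMaxHB.stepBound f p β₂) ⊂ Set.Ioo 0 (MinMaxHB.stepBound f p β₁) ∧
      MinMaxHB.convergentSteps f p β₂ ⊂ MinMaxHB.convergentSteps f p β₁) := by
  have : Nonempty (Fin n ⊕ Fin m) := ⟨finSumFinEquiv.symm ⟨0, hnm⟩⟩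
  have hf₂ : ContDiff ℝ 2 f := hf.of_le (by norm_num)
  have hpos {β : ℝ} (hβ : β ∈ Set.Ioo (-1 : ℝ) 1) : 0 < MinMaxHB.stepBound f p β :=
    MinMaxHB.stepBound_pos hp hdom hker hf₂ hβ
  have hsteps {β : ℝ} (hβ : β ∈ Set.Ioo (-1 : ℝ) 1) :=
    MinMaxHB.convergentSteps_eq hp hdom hker hf hβ
  refine ⟨fun β hβ => ⟨hpos hβ, (hsteps hβ).symm⟩, fun β₁ h₁ β₂ h₂ h => ?_⟩
  have hlt := MinMaxHB.strictAntiOn_stepBound hp hdom hker hf₂ h₁ h₂ h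
  rw [hsteps h₁, hsteps h₂, and_self]
  exact (Set.ssubset_iff_of_subset (Set.Ioo_subset_Ioo_right hlt.le)).2
    ⟨_, ⟨hpos h₂, hlt⟩, fun h' => lt_irrefl _ h'.2⟩

theorem corollary4p7 :
    StrictAntiOn MinMaxHB.momentumFactor (Set.Ioo (-1) 1) ∧
    ∀ (n m : ℕ), 0 < n → 0 < m →
      ∀ (f : MinMaxHB.Strat n m → ℝ) (p : MinMaxHB.Strat n m),
        ContDiff ℝ ∞ f → MinMaxHB.IsLocalNash f p →
        MinMaxHB.InteractionDominates f p → MinMaxHB.EigKerTrivial f p →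
        (∀ β ∈ Set.Ioo (-1 : ℝ) 1,
          0 < MinMaxHB.stepBound f p β ∧
          Set.Ioo 0 (MinMaxHB.stepBound f p β) ⊆ MinMaxHB.convergentSteps f p β) ∧
        (∀ β₁ ∈ Set.Ioo (-1 : ℝ) 1, ∀ β₂ ∈ Set.Ioo (-1 : ℝ) 1, β₁ < β₂ →
          Set.Ioo 0 (MinMaxHB.stepBound f p β₂) ⊂ Set.Ioo 0 (MinMaxHB.stepBound f p β₁) ∧
          MinMaxHB.convergentSteps f p β₂ ⊂ MinMaxHB.convergentSteps f p β₁) := by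
  refine ⟨MinMaxHB.strictAntiOn_momentumFactor, fun n m hn _ f p hf hp hdom hker => ?_⟩
  exact (corollary4p7_general (Nat.add_pos_left hn m) (hf.of_le (WithTop.coe_le_coe.2 le_top))
    hp hdom hker).imp_left fun h β hβ => (h β hβ).imp_right Eq.subset
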